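/- **Theorem 2.** For a matrix $A\in\mathbb{R}^{m\times N}$, weights $w\in[0,\infty)^N$ and $x\in\mathbb{R}^N$, write $\Delta_w(Ax)=x$ (exact reconstruction of $x$) if $x$ is the unique solution of the problem of minimizing $\sum_{i=1}^N |t_i|/w_i$ over all $t\in\mathbb{R}^N$ with $At=Ax$, where $a/0=\infty$ for $a>0$, $0/0=0$, and a solution is required to have a finite objective value (i.e. to be supported in the support of $w$). There are absolute constants $c_0,c_1,c_2>0$ such that the following holds. Let $x\in\mathbb{R}^N$ have support $I$ with $|I|=s$, let $C,\mu>0$ and $0<\delta<1$, and assume $$m\ \ge\ c_0\max\Big[\frac{s}{\delta^2},\ \frac{s\log N}{\mu^2}\Big]\qquad\text{and}\qquad C\le\frac{1-\delta}{\mu}.$$ Let $A$ be a random $m\times N$ matrix whose entries are i.i.d. centered Gaussian variables with variance $1/m$, and let $w=(w_1,\dots,w_N)$ be a (possibly random) vector of non-negative weights on the same probability space, which may depend on $A$ in an arbitrary way. Let $$\Omega(I,C)=\Big\{\,w_i>0 \text{ for all } i\in I,\ \text{ and }\ \max_{i\notin I} w_i\cdot\Big(\sum_{i\in I} w_i^{-2}\Big)^{1/2}\le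 C\Big\},$$ where an empty maximum is $0$. Then, with probability at least $$1-2\exp(-c_1m\delta^2)-\exp\big(-c_2\mu^2m/s\big)-\mathbb{P}\big[\Omega(I,C)^{\complement}\big],$$ one has $\Delta_w(Ax)=x$. (If $s=0$, the term $\exp(-c_2\mu^2m/s)$ is read as $0$.) -/

import Mathlib

open scoped NNReal ENNReal

/-- The support of a vector of `ℝ^N`: the set of its non-zero coordinates. -/
noncomputable def vecSupport {N : ℕ} (x : Fin N → ℝ) : Finset (Fin N) :=
  Finset.univ.filter (fun i => x i ≠ 0)

/-- The weighted `ℓ¹` objective `∑ i, |t i| / w i`, valued in `[0, ∞]`. Division in `ℝ≥0∞` follows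
the conventions `a / 0 = ∞` for `a > 0` and `0 / 0 = 0`. -/
noncomputable def weightedL1 {N : ℕ} (w : Fin N → ℝ≥0) (t : Fin N → ℝ) : ℝ≥0∞ :=
  ∑ i, ‖t i‖ₑ / (w i : ℝ≥0∞)

/-- The solution set of the weighted basis-pursuit problem: minimize `∑ i, |t i| / w i` subject to
`A t = y`. A solution has a finite objective, that is, it vanishes off the support of `w`. -/
def weightedBPSolutions {m N : ℕ} (A : Matrix (Fin m) (Fin N) ℝ) (w : Fin N → ℝ≥0)
    (y : Fin m → ℝ) : Set (Fin N → ℝ) :=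
  {t | A.mulVec t = y ∧ weightedL1 w t ≠ ∞ ∧
    ∀ u : Fin N → ℝ, A.mulVec u = y → weightedL1 w t ≤ weightedL1 w u}

/-- Exact reconstruction `Δ_w(Ax) = x`: the vector `x` is the unique solution of the weighted
basis-pursuit problem with data `y = Ax`. -/
def ExactlyReconstructs {m N : ℕ} (A : Matrix (Fin m) (Fin N) ℝ) (w : Fin N → ℝ≥0)
    (x : Fin N → ℝ) : Prop :=
  weightedBPSolutions A w (A.mulVec x) = {x}

/-- The weight condition `|w_{Iᶜ}|_∞ * |(1/w)_I|₂ ≤ C`. The vector `(1/w)_I` has finite entries,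
that is, `w` does not vanish on `I`. The supremum over an empty `Iᶜ` is `0`. -/
def WeightCondition {N : ℕ} (w : Fin N → ℝ≥0) (I : Finset (Fin N)) (C : ℝ) : Prop :=
  (∀ i ∈ I, w i ≠ 0) ∧
    ((Iᶜ.sup w : ℝ≥0) : ℝ) * Real.sqrt (∑ i ∈ I, (1 / (w i : ℝ)) ^ 2) ≤ C

/-!
# Weighted `ℓ¹` recovery from Gaussian measurements

The recovery statement is deterministic once the null space of `A` is controlled. If every `h` with
`A h = 0` satisfies `‖h_I‖₂ ≤ μ ∑_{j ∉ I} |h_j|`, then for every competitor `t = x + h` of finite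
objective the Cauchy–Schwarz inequality and the weight condition give
`∑_{i ∈ I} |h_i| / w_i ≤ C μ ∑_{j ∉ I} |t_j| / w_j`, and since `C μ ≤ 1 - δ < 1`, leaving the
support of `x` costs strictly more than it can save (`exactlyReconstructs_of_nullSpace`). The null
space property does not mention the weights, so their dependence on `A` is harmless.

Let `M = A_I` be the block of columns of `A` with index in `I`. If `M` is bounded below, so that
`L = (Mᵀ M)⁻¹ Mᵀ` is a left inverse of it, then `A h = 0` forces `h_I = -∑_{j ∉ I} h_j L a_j`.
Hence the null space property follows from `‖L a_j‖₂ ≤ μ` for all columns `a_j`, `j ∉ I`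
(`sqrt_sum_sq_le_of_mulVec_eq_zero`). Two probabilistic facts remain.

* `M` is bounded below by `1/4` outside an event of probability `2 · 33 ^ s · exp (-m / 5)`
  (`measureReal_not_boundedBelow_le`). For a fixed unit vector `u` the entries of `M u` are
  independent Gaussians of variance `1 / m`, so `‖M u‖₂²` has exponential tails by the explicit
  moment generating function of a squared Gaussian; a union bound over a `1/16`-net of the sphere,
  of cardinality at most `33 ^ s` by comparison of volumes, does the rest.
* For `j ∉ I` the column `a_j` is independent of `M`, and for fixed `M` bounded below by `1/4` each
  `⟨u, L a_j⟩` is a centered Gaussian of variance at most `16 / m`; the same net gives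
  `P (‖L a_j‖₂ > μ) ≤ 33 ^ s · exp (-μ² m / 128)` (`measureReal_leftPinv_col_large_le`).

The lower bound on `m` absorbs the factors `33 ^ s` and `N`. The precise value `1 - δ` of the
smallest singular value is never needed, as the spare factor can be moved into the constants.

Neither the weights nor the set of good matrices is assumed to be measurable: all bounds on bad
events are bounds on outer measures, and the event `E` is the complement of a measurable hull.
-/

open scoped Matrix
open MeasureTheory ProbabilityTheory Module

/-! ### Nets of the unit sphere -/

/-- The balls of radius `ε / 2` around the points of `S` are disjoint and lie in the ball of radius
`1 + ε / 2`, which bounds their number by comparison of volumes. -/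
theorem card_le_of_separated_sphere {E : Type*} [NormedAddCommGroup E] [NormedSpace ℝ E]
    [FiniteDimensional ℝ E] {ε : ℝ} (hε : 0 < ε) (S : Finset E) (hS : ∀ u ∈ S, ‖u‖ = 1)
    (hsep : ∀ u ∈ S, ∀ v ∈ S, u ≠ v → ε ≤ ‖u - v‖) :
    (S.card : ℝ) ≤ (1 + 2 / ε) ^ finrank ℝ E := by
  borelize E
  let μ : Measure E := Measure.addHaar
  have hδ : 0 < ε / 2 := by positivity
  have hρ : 0 < 1 + ε / 2 := by positivity
  have hdisj : Set.PairwiseDisjoint (S : Set E) (fun c => Metric.ball c (ε / 2)) := by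
    intro c hc d hd hcd
    apply Metric.ball_disjoint_ball
    rw [dist_eq_norm, add_halves]
    exact hsep c hc d hd hcd
  have hsub : (⋃ c ∈ S, Metric.ball c (ε / 2)) ⊆ Metric.ball (0 : E) (1 + ε / 2) := by
    refine Set.iUnion₂_subset fun c hc => Metric.ball_subset_ball' ?_
    rw [dist_zero_right, hS c hc, add_comm]
  have hvol : (S.card : ℝ≥0∞) * ENNReal.ofReal ((ε / 2) ^ finrank ℝ E) * μ (Metric.ball 0 1) ≤
      ENNReal.ofReal ((1 + ε / 2) ^ finrank ℝ E) * μ (Metric.ball 0 1) := by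
    rw [← μ.addHaar_ball_of_pos 0 hρ]
    refine le_trans (le_of_eq ?_) (measure_mono hsub)
    rw [measure_biUnion_finset hdisj fun c _ => measurableSet_ball]
    simp only [μ.addHaar_ball_of_pos _ hδ, Finset.sum_const, nsmul_eq_mul, mul_assoc]
  have hcard := (ENNReal.mul_le_mul_iff_left
    (Metric.measure_ball_pos μ _ zero_lt_one).ne' measure_ball_lt_top.ne).1 hvol
  have hreal := ENNReal.toReal_le_of_le_ofReal (by positivity) hcard
  rw [ENNReal.toReal_mul, ENNReal.toReal_natCast, ENNReal.toReal_ofReal (by positivity),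
    ← le_div_iff₀ (by positivity), ← div_pow] at hreal
  refine hreal.trans (le_of_eq ?_)
  congr 1
  field_simp
  ring

/-- An `ε`-separated subset of the unit sphere of maximal cardinality is an `ε`-net. -/
theorem exists_sphere_net (E : Type*) [NormedAddCommGroup E] [NormedSpace ℝ E]
    [FiniteDimensional ℝ E] {ε : ℝ} (hε : 0 < ε) :
    ∃ S : Finset E, (∀ u ∈ S, ‖u‖ = 1) ∧ (S.card : ℝ) ≤ (1 + 2 / ε) ^ finrank ℝ E ∧
      ∀ v : E, ‖v‖ = 1 → ∃ u ∈ S, ‖v - u‖ ≤ ε := by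
  classical
  let good : Set ℕ := {n | ∃ S : Finset E, (∀ u ∈ S, ‖u‖ = 1) ∧
    (∀ u ∈ S, ∀ v ∈ S, u ≠ v → ε ≤ ‖u - v‖) ∧ S.card = n}
  have hne : good.Nonempty := ⟨0, ∅, by simp⟩
  have hbdd : BddAbove good := by
    refine ⟨⌊(1 + 2 / ε) ^ finrank ℝ E⌋₊, ?_⟩
    rintro n ⟨S, h1, h2, rfl⟩
    exact Nat.le_floor (card_le_of_separated_sphere hε S h1 h2)
  obtain ⟨S, h1, h2, hcard⟩ := Nat.sSup_mem hne hbdd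
  refine ⟨S, h1, card_le_of_separated_sphere hε S h1 h2, fun v hv => ?_⟩
  by_contra! hfar
  have hvS : v ∉ S := fun h => by
    have := hfar v h
    simp only [sub_self, norm_zero] at this
    linarith
  have hmem : (insert v S).card ∈ good := by
    refine ⟨insert v S, ?_, ?_, rfl⟩
    · simpa [hv] using h1
    · intro a ha b hb hab
      rw [Finset.mem_insert] at ha hb
      rcases ha with rfl | ha <;> rcases hb with rfl | hb
      · exact absurd rfl hab
      · exact (hfar b hb).le
      · rw [norm_sub_rev]; exact (hfar a ha).le
      · exact h2 a ha b hb hab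
  have := le_csSup hbdd hmem
  rw [Finset.card_insert_of_notMem hvS, hcard] at this
  omega

/-- A bound of `T` on an `ε`-net of the sphere controls the operator norm: replacing a unit vector
by a point of the net costs at most `ε ‖T‖`, which is absorbed on the left. -/
theorem norm_le_of_sphere_net {E F : Type*} [NormedAddCommGroup E] [NormedSpace ℝ E]
    [NormedAddCommGroup F] [NormedSpace ℝ F] {ε K : ℝ} (hε : ε < 1) (hK : 0 ≤ K)
    {S : Finset E} (hnet : ∀ v : E, ‖v‖ = 1 → ∃ u ∈ S, ‖v - u‖ ≤ ε)
    (T : E →L[ℝ] F) (hT : ∀ u ∈ S, ‖T u‖ ≤ K) : ‖T‖ ≤ K / (1 - ε) := by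
  have h1 : 0 < 1 - ε := by linarith
  rw [le_div_iff₀ h1]
  suffices ‖T‖ ≤ max (K + ‖T‖ * ε) 0 by
    rcases le_max_iff.1 this with h | h
    · linarith
    · rw [le_antisymm h (norm_nonneg T), zero_mul]; exact hK
  refine T.opNorm_le_of_unit_norm (le_max_right _ _) fun v hv => le_max_of_le_left ?_
  obtain ⟨u, hu, huv⟩ := hnet v hv
  calc ‖T v‖ = ‖T u + T (v - u)‖ := by rw [← map_add]; simp
    _ ≤ ‖T u‖ + ‖T (v - u)‖ := norm_add_le _ _
    _ ≤ K + ‖T‖ * ε := add_le_add (hT u hu) (T.le_of_opNorm_le_of_le le_rfl huv)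

theorem le_norm_apply_of_sphere_net {E F : Type*} [NormedAddCommGroup E] [NormedSpace ℝ E]
    [NormedAddCommGroup F] [NormedSpace ℝ F] {S : Finset E}
    (hnet : ∀ v : E, ‖v‖ = 1 → ∃ u ∈ S, ‖v - u‖ ≤ 1 / 16)
    (T : E →L[ℝ] F) (hT : ∀ u ∈ S, ‖T u‖ ≤ 2) (hT' : ∀ u ∈ S, 1 / 2 ≤ ‖T u‖) (v : E) :
    ‖v‖ / 4 ≤ ‖T v‖ := by
  have hop : ‖T‖ ≤ 4 := (norm_le_of_sphere_net (by norm_num) (by norm_num) hnet T hT).trans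
    (by norm_num)
  rcases eq_or_ne v 0 with rfl | hv
  · simp
  have hv' : 0 < ‖v‖ := norm_pos_iff.2 hv
  obtain ⟨u, hu, huv⟩ := hnet (‖v‖⁻¹ • v) (norm_smul_inv_norm hv)
  have h1 : ‖T u‖ ≤ ‖T (‖v‖⁻¹ • v)‖ + ‖T (‖v‖⁻¹ • v - u)‖ := by
    rw [map_sub]; exact norm_le_norm_add_norm_sub _ _
  have h2 : ‖T (‖v‖⁻¹ • v - u)‖ ≤ 4 * (1 / 16) := T.le_of_opNorm_le_of_le hop huv
  have h3 : ‖T (‖v‖⁻¹ • v)‖ = ‖v‖⁻¹ * ‖T v‖ := by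
    rw [map_smul, norm_smul, norm_inv, norm_norm]
  have h4 : 1 / 4 ≤ ‖v‖⁻¹ * ‖T v‖ := by linarith [hT' u hu]
  rw [inv_mul_eq_div, le_div_iff₀ hv'] at h4
  linarith

/-! ### Linear combinations and squares of Gaussian variables -/

section Gaussian

variable {Ω : Type*} [MeasurableSpace Ω] {P : Measure Ω}

theorem covariance_sum_mul_gaussian {ι : Type*} [Fintype ι] {g : ι → Ω → ℝ} {v : ℝ≥0}
    (hg : ∀ i, HasLaw (g i) (gaussianReal 0 v) P) (hind : iIndepFun g P) (c d : ι → ℝ) :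
    cov[fun ω => ∑ i, c i * g i ω, fun ω => ∑ i, d i * g i ω; P] = v * ∑ i, c i * d i := by
  classical
  have := hind.isProbabilityMeasure
  have hmem : ∀ i, MemLp (g i) 2 P := fun i => by
    have h : MemLp id 2 (P.map (g i)) := by
      rw [(hg i).map_eq]; exact memLp_id_gaussianReal' 2 (by simp)
    exact h.comp_of_map (hg i).aemeasurable
  have hcov : ∀ i j, cov[g i, g j; P] = if i = j then (v : ℝ) else 0 := fun i j => by
    split_ifs with h
    · subst h
      rw [covariance_self (hg i).aemeasurable, (hg i).variance_eq, variance_id_gaussianReal]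
    · exact (hind.indepFun h).covariance_eq_zero (hmem i) (hmem j)
  rw [covariance_fun_sum_fun_sum (fun i => (hmem i).const_mul _) (fun i => (hmem i).const_mul _)]
  simp only [covariance_const_mul_left, covariance_const_mul_right, hcov]
  simp [Finset.mul_sum]
  refine Finset.sum_congr rfl fun i _ => by ring

/-- A linear combination of i.i.d. centered Gaussians is a centered Gaussian. -/
theorem hasLaw_sum_mul_gaussian {ι : Type*} [Fintype ι] {g : ι → Ω → ℝ} {v : ℝ≥0}
    (hg : ∀ i, HasLaw (g i) (gaussianReal 0 v) P) (hind : iIndepFun g P) (c : ι → ℝ) :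
    HasLaw (fun ω => ∑ i, c i * g i ω) (gaussianReal 0 (v * ∑ i, c i ^ 2).toNNReal) P := by
  have := hind.isProbabilityMeasure
  have hjoint : HasGaussianLaw (fun ω => (g · ω)) P :=
    hind.hasGaussianLaw fun i => (hg i).hasGaussianLaw
  have hX : HasGaussianLaw (fun ω => ∑ i, c i * g i ω) P := by
    have := hjoint.map_fun (∑ i, c i • ContinuousLinearMap.proj (R := ℝ) (φ := fun _ : ι => ℝ) i)
    simpa using this
  refine ⟨hX.aemeasurable, ?_⟩
  rw [hX.map_eq_gaussianReal]
  congr 2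
  · rw [integral_finsetSum]
    · simp only [integral_const_mul, (hg _).integral_eq, integral_id_gaussianReal]
      simp
    · intro i _
      exact ((hg i).hasGaussianLaw.integrable).const_mul _
  · rw [← covariance_self hX.aemeasurable, covariance_sum_mul_gaussian hg hind]
    simp [sq]

/-- Linear combinations of i.i.d. centered Gaussians with orthogonal coefficient vectors are
independent, being jointly Gaussian and uncorrelated. -/
theorem iIndepFun_sum_mul_gaussian {ι κ : Type*} [Fintype ι] [Fintype κ] {g : ι → Ω → ℝ} {v : ℝ≥0}
    (hg : ∀ i, HasLaw (g i) (gaussianReal 0 v) P) (hind : iIndepFun g P) (c : κ → ι → ℝ)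
    (hc : ∀ k l, k ≠ l → ∑ i, c k i * c l i = 0) :
    iIndepFun (fun k ω => ∑ i, c k i * g i ω) P := by
  have hjoint : HasGaussianLaw (fun ω => (g · ω)) P :=
    hind.hasGaussianLaw fun i => (hg i).hasGaussianLaw
  refine HasGaussianLaw.iIndepFun_of_covariance_eq_zero ?_ fun k l hkl => ?_
  · have := hjoint.map_fun (ContinuousLinearMap.pi fun k =>
      ∑ i, c k i • ContinuousLinearMap.proj (R := ℝ) (φ := fun _ : ι => ℝ) i)
    have hfun : (fun ω k => ∑ i, c k i * g i ω) = fun ω => (ContinuousLinearMap.pi fun k =>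
        ∑ i, c k i • ContinuousLinearMap.proj (R := ℝ) (φ := fun _ : ι => ℝ) i) (g · ω) := by
      ext ω k
      simp
    rw [hfun]
    exact this
  · rw [covariance_sum_mul_gaussian hg hind, hc k l hkl, mul_zero]

/-- Multiplying a centered Gaussian density by `exp (t x²)` gives a Gaussian of another variance,
up to a constant, as long as `2 t v < 1`. -/
theorem gaussianPDFReal_zero_mul_exp_mul_sq {v : ℝ≥0} (hv : v ≠ 0) (t x : ℝ) :
    gaussianPDFReal 0 v x * Real.exp (t * x ^ 2) =
      (√(2 * Real.pi * v))⁻¹ * Real.exp (-(1 / (2 * v) - t) * x ^ 2) := by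
  have hv' : (0 : ℝ) < v := by positivity
  simp only [gaussianPDFReal, sub_zero]
  rw [mul_assoc, ← Real.exp_add]
  congr 2
  field_simp
  ring

theorem integral_exp_mul_sq_gaussianReal {v : ℝ≥0} (hv : v ≠ 0) {t : ℝ} (ht : 2 * t * v < 1) :
    ∫ x, Real.exp (t * x ^ 2) ∂(gaussianReal 0 v) = (√(1 - 2 * t * v))⁻¹ := by
  have hv' : (0 : ℝ) < v := by positivity
  have hb : 0 < 1 / (2 * v) - t := by
    rw [sub_pos, lt_div_iff₀ (by positivity)]; linarith
  rw [integral_gaussianReal_eq_integral_smul hv]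
  simp_rw [smul_eq_mul, gaussianPDFReal_zero_mul_exp_mul_sq hv]
  rw [integral_const_mul, integral_gaussian, ← Real.sqrt_inv, ← Real.sqrt_inv, ← Real.sqrt_mul
    (by positivity)]
  congr 1
  have : 1 - 2 * t * v ≠ 0 := by linarith
  field_simp

end Gaussian

/-! ### Tail bounds -/

section Tails

variable {Ω : Type*} [MeasurableSpace Ω] {P : Measure Ω}

theorem mgf_sum_sq_gaussian {κ : Type*} [Fintype κ] {X : κ → Ω → ℝ} {v : ℝ≥0} (hv : v ≠ 0)
    (hX : ∀ k, HasLaw (X k) (gaussianReal 0 v) P) (hind : iIndepFun X P) {t : ℝ}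
    (ht : 2 * t * v < 1) :
    mgf (fun ω => ∑ k, X k ω ^ 2) P t = (√(1 - 2 * t * v))⁻¹ ^ Fintype.card κ := by
  have hsq : iIndepFun (fun k ω => X k ω ^ 2) P :=
    hind.comp (fun _ x => x ^ 2) (fun _ => by fun_prop)
  have hsum := hsq.mgf_sum₀ (t := t) (fun k => (hX k).aemeasurable.pow_const 2) Finset.univ
  have hfun : (fun ω => ∑ k, X k ω ^ 2) = ∑ k, fun ω => X k ω ^ 2 := by
    ext ω; simp
  rw [hfun, hsum]
  have hone : ∀ k, mgf (fun ω => X k ω ^ 2) P t = (√(1 - 2 * t * v))⁻¹ := fun k => by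
    rw [← integral_exp_mul_sq_gaussianReal hv ht]
    exact (hX k).integral_comp (f := fun x => Real.exp (t * x ^ 2)) (by fun_prop)
  simp [hone]

theorem integrable_exp_mul_sum_sq_gaussian {κ : Type*} [Fintype κ] {X : κ → Ω → ℝ} {v : ℝ≥0}
    (hv : v ≠ 0) (hX : ∀ k, HasLaw (X k) (gaussianReal 0 v) P) (hind : iIndepFun X P) {t : ℝ}
    (ht : 2 * t * v < 1) :
    Integrable (fun ω => Real.exp (t * ∑ k, X k ω ^ 2)) P := by
  -- The integral is the non-zero product of `mgf_sum_sq_gaussian`; a non-integrable function would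
  -- have integral `0`.
  refine Integrable.of_integral_ne_zero ?_
  have h := mgf_sum_sq_gaussian hv hX hind ht
  rw [mgf] at h
  rw [h]
  have : 0 < 1 - 2 * t * v := by linarith
  positivity

/-- Chernoff bound for the upper tail of `χ²_m / m`, with parameter `3 m / 8`. -/
theorem measureReal_four_le_sum_sq_gaussian {m : ℕ} (hm : m ≠ 0) {X : Fin m → Ω → ℝ}
    (hX : ∀ k, HasLaw (X k) (gaussianReal 0 (1 / (m : ℝ≥0))) P) (hind : iIndepFun X P) :
    P.real {ω | 4 ≤ ∑ k, X k ω ^ 2} ≤ Real.exp (-(m / 5)) := by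
  have := hind.isProbabilityMeasure
  have hm' : (0 : ℝ) < m := by positivity
  have hv : (1 / (m : ℝ≥0)) ≠ 0 := by positivity
  have hval : 1 - 2 * (3 * m / 8) * ((1 / (m : ℝ≥0) : ℝ≥0) : ℝ) = (1 / 2) ^ 2 := by
    push_cast; field_simp; norm_num
  have ht : 2 * (3 * m / 8) * ((1 / (m : ℝ≥0) : ℝ≥0) : ℝ) < 1 := by linarith
  refine (measure_ge_le_exp_mul_mgf (t := 3 * m / 8) 4 (by positivity)
    (integrable_exp_mul_sum_sq_gaussian hv hX hind ht)).trans ?_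
  rw [mgf_sum_sq_gaussian hv hX hind ht, hval, Real.sqrt_sq (by norm_num), Fintype.card_fin]
  have h2 : ((1 / 2 : ℝ)⁻¹) ^ m = Real.exp (m * Real.log 2) := by
    rw [Real.exp_nat_mul, Real.exp_log (by norm_num)]; norm_num
  rw [h2, ← Real.exp_add, Real.exp_le_exp]
  nlinarith [Real.log_two_lt_d9]

/-- Chernoff bound for the lower tail of `χ²_m / m`, with parameter `-m / 2`. -/
theorem measureReal_sum_sq_le_quarter_gaussian {m : ℕ} (hm : m ≠ 0) {X : Fin m → Ω → ℝ}
    (hX : ∀ k, HasLaw (X k) (gaussianReal 0 (1 / (m : ℝ≥0))) P) (hind : iIndepFun X P) :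
    P.real {ω | ∑ k, X k ω ^ 2 ≤ 1 / 4} ≤ Real.exp (-(m / 5)) := by
  have := hind.isProbabilityMeasure
  have hm' : (0 : ℝ) < m := by positivity
  have hv : (1 / (m : ℝ≥0)) ≠ 0 := by positivity
  have hval : 1 - 2 * (-(m / 2)) * ((1 / (m : ℝ≥0) : ℝ≥0) : ℝ) = 2 := by
    push_cast; field_simp; norm_num
  have ht : 2 * (-(m / 2)) * ((1 / (m : ℝ≥0) : ℝ≥0) : ℝ) < 1 := by linarith
  refine (measure_le_le_exp_mul_mgf (t := -(m / 2)) (1 / 4) (by linarith)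
    (integrable_exp_mul_sum_sq_gaussian hv hX hind ht)).trans ?_
  rw [mgf_sum_sq_gaussian hv hX hind ht, hval, Fintype.card_fin]
  have h2 : (√2)⁻¹ ^ m = Real.exp (-(m * (Real.log 2 / 2))) := by
    rw [Real.exp_neg, Real.exp_nat_mul, ← Real.log_sqrt (by norm_num), Real.exp_log (by positivity),
      inv_pow]
  rw [h2, ← Real.exp_add, Real.exp_le_exp]
  nlinarith [Real.log_two_gt_d9]

/-- The upper bound `K` on `∑ i, c i ^ 2`, instead of the sum itself, enters the exponent. This keeps
the estimate valid, and free of a division by `0`, when `c = 0` and `K ≠ 0`. -/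
theorem measureReal_le_sum_mul_gaussian {ι : Type*} [Fintype ι] {g : ι → Ω → ℝ} {v : ℝ≥0}
    (hg : ∀ i, HasLaw (g i) (gaussianReal 0 v) P) (hind : iIndepFun g P) (c : ι → ℝ) {K : ℝ≥0}
    (hc : ∑ i, c i ^ 2 ≤ K) {r : ℝ} (hr : 0 ≤ r) :
    P.real {ω | r ≤ ∑ i, c i * g i ω} ≤ Real.exp (-r ^ 2 / (2 * (v * K))) := by
  have hlaw := hasLaw_sum_mul_gaussian hg hind c
  have hsub : HasSubgaussianMGF (fun ω => ∑ i, c i * g i ω) (v * K) P := by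
    refine ⟨fun t => ?_, fun t => ?_⟩
    · have h := integrable_exp_mul_gaussianReal (μ := 0) (v := (v * ∑ i, c i ^ 2).toNNReal) t
      rw [← hlaw.map_eq] at h
      exact h.comp_aemeasurable hlaw.aemeasurable
    · rw [mgf_gaussianReal hlaw.map_eq, Real.coe_toNNReal _ (by positivity), zero_mul, zero_add]
      push_cast
      gcongr
  simpa using hsub.measure_ge_le hr

end Tails

/-! ### The smallest singular value of a Gaussian matrix -/

section SingularValue

variable {Ω : Type*} [MeasurableSpace Ω] {P : Measure Ω}

/-- The smallest singular value of `M` is at least `1/4`, that is, `‖v‖₂ ≤ 4 ‖M v‖₂` for all `v`.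
The inequality is squared, so that only finite sums of squares occur. -/
def BoundedBelow {κ ι : Type*} [Fintype κ] [Fintype ι] (M : Matrix κ ι ℝ) : Prop :=
  ∀ v : ι → ℝ, ∑ i, v i ^ 2 ≤ 16 * ∑ k, (M *ᵥ v) k ^ 2

theorem boundedBelow_of_sphere_net {κ ι : Type*} [Fintype κ] [Fintype ι] [DecidableEq ι]
    {S : Finset (EuclideanSpace ℝ ι)}
    (hnet : ∀ v : EuclideanSpace ℝ ι, ‖v‖ = 1 → ∃ u ∈ S, ‖v - u‖ ≤ 1 / 16)
    (M : Matrix κ ι ℝ) (hM : ∀ u ∈ S, ∑ k, (M *ᵥ u.ofLp) k ^ 2 < 4)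
    (hM' : ∀ u ∈ S, 1 / 4 < ∑ k, (M *ᵥ u.ofLp) k ^ 2) : BoundedBelow M := by
  intro v
  let T : EuclideanSpace ℝ ι →L[ℝ] EuclideanSpace ℝ κ :=
    (Matrix.toLpLin 2 2 M).toContinuousLinearMap
  have hT : ∀ u, ‖T u‖ ^ 2 = ∑ k, (M *ᵥ u.ofLp) k ^ 2 := fun u => by
    rw [EuclideanSpace.real_norm_sq_eq]
    rfl
  have h := le_norm_apply_of_sphere_net hnet T
    (fun u hu => by
      have := hM u hu
      rw [← hT] at this
      nlinarith [norm_nonneg (T u)])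
    (fun u hu => by
      have := hM' u hu
      rw [← hT] at this
      nlinarith [norm_nonneg (T u)]) (WithLp.toLp 2 v)
  have h1 : ‖WithLp.toLp 2 v‖ ^ 2 = ∑ i, v i ^ 2 := EuclideanSpace.real_norm_sq_eq _
  have h2 := hT (WithLp.toLp 2 v)
  rw [← h1, ← h2]
  nlinarith [norm_nonneg (WithLp.toLp 2 v)]

theorem measureReal_not_boundedBelow_le {ι : Type*} [Fintype ι] {m : ℕ} (hm : m ≠ 0)
    {M : Ω → Matrix (Fin m) ι ℝ}
    (hM : ∀ k i, HasLaw (fun ω => M ω k i) (gaussianReal 0 (1 / (m : ℝ≥0))) P)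
    (hind : iIndepFun (fun (p : Fin m × ι) ω => M ω p.1 p.2) P) :
    P.real {ω | ¬ BoundedBelow (M ω)} ≤
      2 * 33 ^ Fintype.card ι * Real.exp (-(m / 5)) := by
  classical
  have := hind.isProbabilityMeasure
  obtain ⟨S, hS, hcard, hnet⟩ := exists_sphere_net (EuclideanSpace ℝ ι) (ε := 1 / 16) (by norm_num)
  have hcard' : (S.card : ℝ) ≤ 33 ^ Fintype.card ι := by
    refine hcard.trans (le_of_eq ?_)
    rw [finrank_euclideanSpace]
    norm_num
  -- The entries of `M u` are combinations of all entries of `M`, with coefficient vectors which for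
  -- distinct rows have disjoint supports.
  have hrow : ∀ u : EuclideanSpace ℝ ι, ∀ k ω, (M ω *ᵥ u.ofLp) k =
      ∑ p : Fin m × ι, (if p.1 = k then u p.2 else 0) * M ω p.1 p.2 := fun u k ω => by
    rw [Fintype.sum_prod_type]
    simp [Matrix.mulVec, dotProduct, mul_comm]
  have hlaw : ∀ u ∈ S, ∀ k, HasLaw (fun ω => (M ω *ᵥ u.ofLp) k)
      (gaussianReal 0 (1 / (m : ℝ≥0))) P := fun u hu k => by
    have h := hasLaw_sum_mul_gaussian (g := fun (p : Fin m × ι) ω => M ω p.1 p.2)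
      (fun p => hM p.1 p.2) hind (fun p => if p.1 = k then u p.2 else 0)
    have hsum : ∑ p : Fin m × ι, (if p.1 = k then u p.2 else 0) ^ 2 = 1 := by
      rw [Fintype.sum_prod_type]
      simp only [ite_pow, ne_eq, OfNat.ofNat_ne_zero, not_false_eq_true, zero_pow]
      rw [Finset.sum_eq_single k (by simp +contextual) (by simp)]
      simp [← EuclideanSpace.real_norm_sq_eq, hS u hu]
    simp_rw [hrow]
    rw [hsum, mul_one, Real.toNNReal_coe] at h
    exact h
  have hindep : ∀ u : EuclideanSpace ℝ ι, iIndepFun (fun k ω => (M ω *ᵥ u.ofLp) k) P := fun u => by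
    simp_rw [hrow]
    refine iIndepFun_sum_mul_gaussian (g := fun (p : Fin m × ι) ω => M ω p.1 p.2)
      (fun p => hM p.1 p.2) hind _ fun k l hkl => Finset.sum_eq_zero fun p _ => ?_
    by_cases h : p.1 = k
    · simp [h, hkl]
    · simp [h]
  have hsub : {ω | ¬ BoundedBelow (M ω)} ⊆ ⋃ u ∈ S,
      ({ω | 4 ≤ ∑ k, (M ω *ᵥ u.ofLp) k ^ 2} ∪ {ω | ∑ k, (M ω *ᵥ u.ofLp) k ^ 2 ≤ 1 / 4}) := by
    intro ω hω
    by_contra hcon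
    simp only [Set.mem_iUnion, Set.mem_union, Set.mem_ofPred_eq, exists_prop, not_exists, not_and,
      not_or, not_le] at hcon
    exact hω (boundedBelow_of_sphere_net hnet _ (fun u hu => (hcon u hu).1)
      (fun u hu => (hcon u hu).2))
  calc P.real {ω | ¬ BoundedBelow (M ω)}
      ≤ ∑ u ∈ S, P.real
          ({ω | 4 ≤ ∑ k, (M ω *ᵥ u.ofLp) k ^ 2} ∪ {ω | ∑ k, (M ω *ᵥ u.ofLp) k ^ 2 ≤ 1 / 4}) :=
        (measureReal_mono hsub (measure_ne_top _ _)).trans (measureReal_biUnion_finset_le _ _)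
    _ ≤ ∑ u ∈ S, 2 * Real.exp (-(m / 5)) := by
        refine Finset.sum_le_sum fun u hu => (measureReal_union_le _ _).trans ?_
        rw [two_mul]
        exact add_le_add (measureReal_four_le_sum_sq_gaussian hm (hlaw u hu) (hindep u))
          (measureReal_sum_sq_le_quarter_gaussian hm (hlaw u hu) (hindep u))
    _ = S.card * (2 * Real.exp (-(m / 5))) := by rw [Finset.sum_const, nsmul_eq_mul]
    _ ≤ 33 ^ Fintype.card ι * (2 * Real.exp (-(m / 5))) := by gcongr
    _ = _ := by ring

end SingularValue

/-! ### The pseudo-inverse applied to an independent Gaussian vector -/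

section PseudoInverse

variable {Ω : Type*} [MeasurableSpace Ω] {P : Measure Ω}

/-- The pseudo-inverse `(Mᵀ M)⁻¹ Mᵀ` of a matrix with linearly independent columns. It carries no
information when `Mᵀ M` is singular, as the matrix inverse is then `0`. -/
noncomputable def leftPinv {κ ι : Type*} [Fintype κ] [Fintype ι] [DecidableEq ι]
    (M : Matrix κ ι ℝ) : Matrix ι κ ℝ := (Mᵀ * M)⁻¹ * Mᵀ

theorem BoundedBelow.mulVec_injective {κ ι : Type*} [Fintype κ] [Fintype ι]
    {M : Matrix κ ι ℝ} (hM : BoundedBelow M) : Function.Injective M.mulVec := by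
  intro x y hxy
  have h := hM (x - y)
  rw [Matrix.mulVec_sub, sub_eq_zero.2 hxy] at h
  simp only [Pi.zero_apply, ne_eq, OfNat.ofNat_ne_zero, not_false_eq_true, zero_pow,
    Finset.sum_const_zero, mul_zero] at h
  have h0 := (Finset.sum_eq_zero_iff_of_nonneg (fun i _ => sq_nonneg _)).1
    (le_antisymm h (Finset.sum_nonneg fun i _ => sq_nonneg ((x - y) i)))
  ext i
  have := h0 i (Finset.mem_univ i)
  simpa [sub_eq_zero] using this

theorem BoundedBelow.isUnit_gram {κ ι : Type*} [Fintype κ] [Fintype ι] [DecidableEq ι]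
    {M : Matrix κ ι ℝ} (hM : BoundedBelow M) : IsUnit (Mᵀ * M) := by
  rw [← Matrix.mulVec_injective_iff_isUnit]
  intro x y hxy
  have h : (Mᵀ * M) *ᵥ (x - y) = 0 := by rw [Matrix.mulVec_sub, sub_eq_zero]; exact hxy
  rw [← Matrix.conjTranspose_eq_transpose_of_trivial,
    Matrix.conjTranspose_mul_self_mulVec_eq_zero] at h
  rw [Matrix.mulVec_sub, sub_eq_zero] at h
  exact hM.mulVec_injective h

theorem BoundedBelow.leftPinv_mul {κ ι : Type*} [Fintype κ] [Fintype ι] [DecidableEq ι]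
    {M : Matrix κ ι ℝ} (hM : BoundedBelow M) : leftPinv M * M = 1 := by
  rw [leftPinv, Matrix.mul_assoc]
  exact Matrix.nonsing_inv_mul _ ((Matrix.isUnit_iff_isUnit_det _).1 hM.isUnit_gram)

/-- The transpose of the pseudo-inverse has norm at most `4`. Writing `y = (Mᵀ M)⁻¹ u`, one has
`uᵀ L = (M y)ᵀ` and `‖M y‖₂² = ⟨y, u⟩ ≤ ‖y‖₂ ‖u‖₂ ≤ 4 ‖M y‖₂ ‖u‖₂`. -/
theorem BoundedBelow.sum_vecMul_leftPinv_sq_le {κ ι : Type*} [Fintype κ] [Fintype ι] [DecidableEq ι]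
    {M : Matrix κ ι ℝ} (hM : BoundedBelow M) (u : ι → ℝ) :
    ∑ k, (u ᵥ* leftPinv M) k ^ 2 ≤ 16 * ∑ i, u i ^ 2 := by
  set y := (Mᵀ * M)⁻¹ *ᵥ u with hy
  have hsymm : (Mᵀ * M)⁻¹ᵀ = (Mᵀ * M)⁻¹ := by
    rw [Matrix.transpose_nonsing_inv, Matrix.transpose_mul, Matrix.transpose_transpose]
  have h1 : u ᵥ* leftPinv M = M *ᵥ y := by
    rw [leftPinv, ← Matrix.vecMul_vecMul, Matrix.vecMul_transpose, ← Matrix.mulVec_transpose, hsymm]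
  have h2 : (Mᵀ * M) *ᵥ y = u := by
    rw [hy, Matrix.mulVec_mulVec,
      Matrix.mul_nonsing_inv _ ((Matrix.isUnit_iff_isUnit_det _).1 hM.isUnit_gram),
      Matrix.one_mulVec]
  have h3 : ∑ k, (M *ᵥ y) k ^ 2 = ∑ i, y i * u i := by
    have : (M *ᵥ y) ⬝ᵥ (M *ᵥ y) = y ⬝ᵥ u := by
      conv_rhs => rw [← h2, ← Matrix.mulVec_mulVec, Matrix.dotProduct_mulVec,
        Matrix.vecMul_transpose]
    simpa [dotProduct, sq] using this
  have h4 := hM y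
  have h5 := Finset.sum_mul_sq_le_sq_mul_sq Finset.univ y u
  rw [h1]
  rw [← h3] at h5
  set a := ∑ k, (M *ᵥ y) k ^ 2
  have ha : 0 ≤ a := Finset.sum_nonneg fun _ _ => sq_nonneg _
  have hu : 0 ≤ ∑ i, u i ^ 2 := Finset.sum_nonneg fun _ _ => sq_nonneg _
  rcases ha.eq_or_lt with h0 | h0
  · rw [← h0]; positivity
  · have : a * a ≤ a * (16 * ∑ i, u i ^ 2) := by nlinarith
    exact le_of_mul_le_mul_left this h0

/-- A unit vector close to the direction of `z = L a` detects its norm, so `‖z‖₂ > r` implies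
`⟨u, z⟩ ≥ (1 - 1/16) ‖z‖₂ ≥ r / 2` for some `u` in a `1/16`-net of the sphere. -/
theorem measureReal_leftPinv_mulVec_large_le {ι : Type*} [Fintype ι] [DecidableEq ι] {m : ℕ}
    {M : Matrix (Fin m) ι ℝ} (hM : BoundedBelow M) {a : Ω → Fin m → ℝ}
    (ha : ∀ k, HasLaw (fun ω => a ω k) (gaussianReal 0 (1 / (m : ℝ≥0))) P)
    (hind : iIndepFun (fun k ω => a ω k) P) {r : ℝ} (hr : 0 < r) :
    P.real {ω | r ^ 2 < ∑ i, (leftPinv M *ᵥ a ω) i ^ 2} ≤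
      33 ^ Fintype.card ι * Real.exp (-(r ^ 2 * m / 128)) := by
  have := hind.isProbabilityMeasure
  obtain ⟨S, hS, hcard, hnet⟩ := exists_sphere_net (EuclideanSpace ℝ ι) (ε := 1 / 16) (by norm_num)
  have hcard' : (S.card : ℝ) ≤ 33 ^ Fintype.card ι := by
    refine hcard.trans (le_of_eq ?_)
    rw [finrank_euclideanSpace]
    norm_num
  have hsub : {ω | r ^ 2 < ∑ i, (leftPinv M *ᵥ a ω) i ^ 2} ⊆
      ⋃ u ∈ S, {ω | r / 2 ≤ ∑ k, (u.ofLp ᵥ* leftPinv M) k * a ω k} := by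
    intro ω hω
    rw [Set.mem_ofPred_eq] at hω
    set z : EuclideanSpace ℝ ι := WithLp.toLp 2 (leftPinv M *ᵥ a ω) with hz
    have hnorm : ‖z‖ ^ 2 = ∑ i, (leftPinv M *ᵥ a ω) i ^ 2 := EuclideanSpace.real_norm_sq_eq _
    rw [← hnorm] at hω
    have hrz : r < ‖z‖ := lt_of_pow_lt_pow_left₀ 2 (norm_nonneg _) hω
    have hz0 : z ≠ 0 := norm_pos_iff.1 (hr.trans hrz)
    obtain ⟨u, hu, huz⟩ := hnet (‖z‖⁻¹ • z) (norm_smul_inv_norm hz0)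
    have hinner : ∑ k, (u.ofLp ᵥ* leftPinv M) k * a ω k = inner ℝ u z := by
      have h1 : ∑ k, (u.ofLp ᵥ* leftPinv M) k * a ω k = u.ofLp ⬝ᵥ (leftPinv M *ᵥ a ω) := by
        rw [Matrix.dotProduct_mulVec]; rfl
      rw [h1, EuclideanSpace.inner_eq_star_dotProduct, dotProduct_comm]
      rfl
    have h2 : inner ℝ (‖z‖⁻¹ • z - u) z ≤ 1 / 16 * ‖z‖ :=
      (real_inner_le_norm _ _).trans (by gcongr)
    rw [inner_sub_left, real_inner_smul_left, real_inner_self_eq_norm_sq] at h2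
    have h3 : ‖z‖⁻¹ * ‖z‖ ^ 2 = ‖z‖ := by
      have := norm_ne_zero_iff.2 hz0
      field_simp
    simp only [Set.mem_iUnion, Set.mem_ofPred_eq, exists_prop]
    exact ⟨u, hu, by rw [hinner]; linarith⟩
  calc P.real {ω | r ^ 2 < ∑ i, (leftPinv M *ᵥ a ω) i ^ 2}
      ≤ ∑ u ∈ S, P.real {ω | r / 2 ≤ ∑ k, (u.ofLp ᵥ* leftPinv M) k * a ω k} :=
        (measureReal_mono hsub (measure_ne_top _ _)).trans (measureReal_biUnion_finset_le _ _)
    _ ≤ ∑ u ∈ S, Real.exp (-(r ^ 2 * m / 128)) := by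
        refine Finset.sum_le_sum fun u hu => ?_
        have hc : ∑ k, (u.ofLp ᵥ* leftPinv M) k ^ 2 ≤ ((16 : ℝ≥0) : ℝ) := by
          have h := hM.sum_vecMul_leftPinv_sq_le u.ofLp
          rw [← EuclideanSpace.real_norm_sq_eq, hS u hu] at h
          simpa using h
        refine (measureReal_le_sum_mul_gaussian (g := fun k ω => a ω k) ha hind _ hc
          (by positivity)).trans (le_of_eq ?_)
        congr 1
        push_cast
        rcases eq_or_ne m 0 with rfl | hm
        · simp
        · field_simp
          norm_num
    _ = S.card * Real.exp (-(r ^ 2 * m / 128)) := by rw [Finset.sum_const, nsmul_eq_mul]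
    _ ≤ 33 ^ Fintype.card ι * Real.exp (-(r ^ 2 * m / 128)) := by gcongr

/-- A bound on the probability of `(x, Y) ∈ S` which is uniform in the value `x` of `X` holds for
`(X, Y) ∈ S` when `X` and `Y` are independent, by Fubini's theorem. -/
theorem ProbabilityTheory.IndepFun.measure_mem_le {α β : Type*} [MeasurableSpace α]
    [MeasurableSpace β] [IsProbabilityMeasure P] {X : Ω → α} {Y : Ω → β} (hXY : IndepFun X Y P)
    (hX : AEMeasurable X P) (hY : AEMeasurable Y P) {S : Set (α × β)} (hS : MeasurableSet S)
    {b : ℝ≥0∞} (hb : ∀ x, P {ω | (x, Y ω) ∈ S} ≤ b) : P {ω | (X ω, Y ω) ∈ S} ≤ b := by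
  have := Measure.isProbabilityMeasure_map hX
  have := Measure.isProbabilityMeasure_map hY
  calc P {ω | (X ω, Y ω) ∈ S} = P.map (fun ω => (X ω, Y ω)) S :=
        (Measure.map_apply_of_aemeasurable (hX.prodMk hY) hS).symm
    _ = ∫⁻ x, P.map Y (Prod.mk x ⁻¹' S) ∂(P.map X) := by
        rw [(indepFun_iff_map_prod_eq_prod_map_map hX hY).1 hXY, Measure.prod_apply hS]
    _ ≤ ∫⁻ _, b ∂(P.map X) := by
        refine lintegral_mono fun x => ?_
        rw [Measure.map_apply_of_aemeasurable hY (measurable_prodMk_left hS)]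
        exact hb x
    _ = b := by simp

theorem measurableSet_boundedBelow {κ ι : Type*} [Fintype κ] [Fintype ι] :
    MeasurableSet {M : κ → ι → ℝ | BoundedBelow (Matrix.of M)} := by
  refine IsClosed.measurableSet ?_
  have : {M : κ → ι → ℝ | BoundedBelow (Matrix.of M)} = ⋂ v : ι → ℝ,
      {M | ∑ i, v i ^ 2 ≤ 16 * ∑ k, (∑ i, M k i * v i) ^ 2} := by
    ext M; simp [BoundedBelow, Matrix.mulVec, dotProduct]
  rw [this]
  exact isClosed_iInter fun v => isClosed_le (by fun_prop) (by fun_prop)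

/-- Cramer's rule shows that the entries of the pseudo-inverse are measurable, although they are
discontinuous at the matrices with singular Gram matrix. -/
theorem measurable_leftPinv_apply {κ ι : Type*} [Fintype κ] [Fintype ι] [DecidableEq ι]
    (i : ι) (k : κ) : Measurable fun M : κ → ι → ℝ => leftPinv (Matrix.of M) i k := by
  have hgram : Continuous fun M : κ → ι → ℝ => (Matrix.of M)ᵀ * Matrix.of M :=
    Continuous.matrix_mul (Continuous.matrix_transpose continuous_id) continuous_id
  simp only [leftPinv, Matrix.inv_def, Ring.inverse_eq_inv', Matrix.smul_apply,
    Matrix.mul_apply, Matrix.transpose_apply, Matrix.of_apply, smul_eq_mul]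
  exact Finset.measurable_sum _ fun j _ => (hgram.matrix_det.measurable.inv.mul
    (hgram.matrix_adjugate.matrix_elem i j).measurable).mul (by fun_prop)

theorem measurableSet_leftPinv_large {κ ι : Type*} [Fintype κ] [Fintype ι] [DecidableEq ι] (r : ℝ) :
    MeasurableSet {p : (κ → ι → ℝ) × (κ → ℝ) | BoundedBelow (Matrix.of p.1) ∧
      r ^ 2 < ∑ i, (leftPinv (Matrix.of p.1) *ᵥ p.2) i ^ 2} := by
  suffices hsum : Measurable fun p : (κ → ι → ℝ) × (κ → ℝ) =>
      ∑ i, (leftPinv (Matrix.of p.1) *ᵥ p.2) i ^ 2 from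
    (measurable_fst measurableSet_boundedBelow).inter (measurableSet_lt measurable_const hsum)
  simp only [Matrix.mulVec, dotProduct]
  refine Finset.measurable_sum _ fun i _ => Measurable.pow_const
    (Finset.measurable_sum _ fun k _ => Measurable.mul ?_ (by fun_prop)) 2
  exact (measurable_leftPinv_apply i k).comp measurable_fst

/-- Two subfamilies of an independent family with disjoint index sets are independent. The
subfamilies are indexed by arbitrary types. -/
theorem ProbabilityTheory.iIndepFun.indepFun_reindex {ι α β : Type*} {f : ι → Ω → ℝ}
    (hind : iIndepFun f P) (hf : ∀ i, AEMeasurable (f i) P) {S T : Finset ι} (hST : Disjoint S T)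
    {a : α → ι} {b : β → ι} (ha : ∀ i, a i ∈ S) (hb : ∀ j, b j ∈ T) :
    IndepFun (fun ω i => f (a i) ω) (fun ω j => f (b j) ω) P :=
  (hind.indepFun_finset₀ S T hST hf).comp
    (φ := fun (g : S → ℝ) i => g ⟨a i, ha i⟩) (ψ := fun (g : T → ℝ) j => g ⟨b j, hb j⟩)
    (by fun_prop) (by fun_prop)

/-- Conditionally on the columns indexed by `I`, the column `j ∉ I` is still Gaussian, so the estimate
for a fixed matrix applies. -/
theorem measureReal_leftPinv_col_large_le {m N : ℕ} {A : Ω → Matrix (Fin m) (Fin N) ℝ}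
    (hA : ∀ i j, HasLaw (fun ω => A ω i j) (gaussianReal 0 (1 / (m : ℝ≥0))) P)
    (hind : iIndepFun (fun (p : Fin m × Fin N) ω => A ω p.1 p.2) P) (I : Finset (Fin N))
    {j : Fin N} (hj : j ∉ I) {r : ℝ} (hr : 0 < r) :
    P.real {ω | BoundedBelow ((A ω).submatrix id (Subtype.val : I → Fin N)) ∧
        r ^ 2 < ∑ i, (leftPinv ((A ω).submatrix id (Subtype.val : I → Fin N)) *ᵥ
          fun k => A ω k j) i ^ 2} ≤
      33 ^ I.card * Real.exp (-(r ^ 2 * m / 128)) := by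
  have := hind.isProbabilityMeasure
  have hmeas : ∀ p : Fin m × Fin N, AEMeasurable (fun ω => A ω p.1 p.2) P :=
    fun p => (hA p.1 p.2).aemeasurable
  let X : Ω → Fin m → I → ℝ := fun ω k i => A ω k i
  let Y : Ω → Fin m → ℝ := fun ω k => A ω k j
  have hdisj : Disjoint (Finset.univ ×ˢ I : Finset (Fin m × Fin N)) (Finset.univ ×ˢ {j}) :=
    Finset.disjoint_product.2 (Or.inr (by simpa using hj))
  have hXY : IndepFun X Y P := by
    have h := hind.indepFun_reindex hmeas hdisj
      (a := fun p : Fin m × I => (p.1, p.2.1)) (b := fun k : Fin m => (k, j))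
      (fun p => by simp) (fun k => by simp)
    exact h.comp (φ := fun (f : Fin m × I → ℝ) k i => f (k, i)) (ψ := id) (by fun_prop)
      measurable_id
  have hX : AEMeasurable X P :=
    aemeasurable_pi_lambda _ fun k => aemeasurable_pi_lambda _ fun i => hmeas (k, i)
  have hY : AEMeasurable Y P := aemeasurable_pi_lambda _ fun k => hmeas (k, j)
  have hYind : iIndepFun (fun k ω => Y ω k) P :=
    hind.precomp (g := fun k : Fin m => (k, j)) fun k l h => (Prod.mk.inj h).1
  refine ENNReal.toReal_le_of_le_ofReal (by positivity) ?_
  refine hXY.measure_mem_le hX hY (measurableSet_leftPinv_large (κ := Fin m) (ι := I) r)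
    fun M => ?_
  by_cases hM : BoundedBelow (Matrix.of M)
  · have h := measureReal_leftPinv_mulVec_large_le hM (fun k => hA k j) hYind hr
    rw [Fintype.card_coe] at h
    simpa [hM] using (ENNReal.le_ofReal_iff_toReal_le (measure_ne_top _ _) (by positivity)).2 h
  · simp [hM]

end PseudoInverse

/-! ### Recovery from a null space property -/

section Deterministic

/-- The objective is finite exactly for the vectors supported in the support of `w`. -/
theorem weightedL1_ne_top_iff {N : ℕ} (w : Fin N → ℝ≥0) (t : Fin N → ℝ) :
    weightedL1 w t ≠ ∞ ↔ ∀ i, w i = 0 → t i = 0 := by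
  simp only [weightedL1, ne_eq, ENNReal.sum_eq_top, Finset.mem_univ, true_and, not_exists]
  refine forall_congr' fun i => ?_
  rw [ENNReal.div_eq_top]
  simp
  tauto

theorem weightedL1_eq_ofReal {N : ℕ} {w : Fin N → ℝ≥0} {t : Fin N → ℝ}
    (ht : ∀ i, w i = 0 → t i = 0) :
    weightedL1 w t = ENNReal.ofReal (∑ i, |t i| / w i) := by
  rw [weightedL1, ENNReal.ofReal_sum_of_nonneg (fun i _ => by positivity)]
  refine Finset.sum_congr rfl fun i _ => ?_
  rcases eq_or_ne (w i) 0 with h | h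
  · simp [h, ht i h]
  · rw [ENNReal.ofReal_div_of_pos (by positivity), ENNReal.ofReal_coe_nnreal,
      Real.enorm_eq_ofReal_abs]

/-- The objective grows by at least `(1 - C μ) ∑_{i ∉ I} |t i| / w i` when `x` is replaced by another
feasible vector `t` of finite objective. The divisions by `w i = 0` that occur have numerator `0`. -/
theorem sum_div_weight_add_le {m N : ℕ} {A : Matrix (Fin m) (Fin N) ℝ} {w : Fin N → ℝ≥0}
    {x t : Fin N → ℝ} {I : Finset (Fin N)} {C μ : ℝ} (hμ : 0 < μ) (hx : ∀ i ∉ I, x i = 0)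
    (hw : WeightCondition w I C)
    (hA : ∀ h : Fin N → ℝ, A *ᵥ h = 0 → √(∑ i ∈ I, h i ^ 2) ≤ μ * ∑ i ∈ Iᶜ, |h i|)
    (hAt : A *ᵥ t = A *ᵥ x) (ht : ∀ i, w i = 0 → t i = 0) :
    ∑ i, |x i| / w i + (1 - C * μ) * ∑ i ∈ Iᶜ, |t i| / w i ≤ ∑ i, |t i| / w i := by
  set W : ℝ := ((Iᶜ.sup w : ℝ≥0) : ℝ)
  set R : ℝ := √(∑ i ∈ I, (1 / (w i : ℝ)) ^ 2)
  set D : ℝ := ∑ i ∈ Iᶜ, |t i| / w i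
  have hD : 0 ≤ D := Finset.sum_nonneg fun i _ => by positivity
  have hR : 0 ≤ R := Real.sqrt_nonneg _
  have hker : A *ᵥ (t - x) = 0 := by rw [Matrix.mulVec_sub, hAt, sub_self]
  have hcompl : ∑ i ∈ Iᶜ, |(t - x) i| = ∑ i ∈ Iᶜ, |t i| :=
    Finset.sum_congr rfl fun i hi => by simp [hx i (by simpa using hi)]
  have htail : ∑ i ∈ Iᶜ, |t i| ≤ W * D := by
    rw [Finset.mul_sum]
    refine Finset.sum_le_sum fun i hi => ?_
    rcases eq_or_ne (w i) 0 with h | h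
    · simp [h, ht i h]
    · have hwi : (0 : ℝ) < w i := by positivity
      have hle : (w i : ℝ) ≤ W := NNReal.coe_le_coe.2 (Finset.le_sup hi)
      calc |t i| = w i * (|t i| / w i) := by field_simp
        _ ≤ W * (|t i| / w i) := by gcongr
  have hhead : ∑ i ∈ I, |(t - x) i| / w i ≤ C * μ * D := by
    calc ∑ i ∈ I, |(t - x) i| / w i = ∑ i ∈ I, |(t - x) i| * (1 / (w i : ℝ)) :=
          Finset.sum_congr rfl fun i _ => by ring
      _ ≤ √(∑ i ∈ I, |(t - x) i| ^ 2) * R := Real.sum_mul_le_sqrt_mul_sqrt _ _ _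
      _ = √(∑ i ∈ I, (t - x) i ^ 2) * R := by simp only [sq_abs]
      _ ≤ (μ * (W * D)) * R := by
          gcongr
          refine (hA _ hker).trans ?_
          rw [hcompl]
          gcongr
      _ = (W * R) * (μ * D) := by ring
      _ ≤ C * (μ * D) := by gcongr; exact hw.2
      _ = C * μ * D := by ring
  have hxI : ∑ i ∈ I, |x i| / w i ≤ ∑ i ∈ I, |t i| / w i + ∑ i ∈ I, |(t - x) i| / w i := by
    rw [← Finset.sum_add_distrib]
    refine Finset.sum_le_sum fun i _ => ?_
    rw [← add_div]
    gcongr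
    have := abs_sub_abs_le_abs_sub (x i) (t i)
    rw [abs_sub_comm] at this
    simp only [Pi.sub_apply]
    linarith
  have hxIc : ∑ i ∈ Iᶜ, |x i| / w i = 0 :=
    Finset.sum_eq_zero fun i hi => by simp [hx i (by simpa using hi)]
  rw [← Finset.sum_add_sum_compl I fun i => |x i| / (w i : ℝ),
    ← Finset.sum_add_sum_compl I fun i => |t i| / (w i : ℝ), hxIc]
  change _ ≤ _ + D
  linarith

theorem exactlyReconstructs_of_nullSpace {m N : ℕ} {A : Matrix (Fin m) (Fin N) ℝ}
    {w : Fin N → ℝ≥0} {x : Fin N → ℝ} {I : Finset (Fin N)} {C μ : ℝ} (hμ : 0 < μ) (hC : C * μ < 1)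
    (hx : ∀ i ∉ I, x i = 0) (hw : WeightCondition w I C)
    (hA : ∀ h : Fin N → ℝ, A *ᵥ h = 0 → √(∑ i ∈ I, h i ^ 2) ≤ μ * ∑ i ∈ Iᶜ, |h i|) :
    ExactlyReconstructs A w x := by
  have hxw : ∀ i, w i = 0 → x i = 0 := fun i hi => hx i fun hiI => hw.1 i hiI hi
  have hnn : ∀ t : Fin N → ℝ, 0 ≤ (1 - C * μ) * ∑ i ∈ Iᶜ, |t i| / (w i : ℝ) := fun t =>
    mul_nonneg (by linarith) (Finset.sum_nonneg fun i _ => by positivity)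
  refine Set.eq_singleton_iff_unique_mem.2 ⟨⟨rfl, (weightedL1_ne_top_iff w x).2 hxw, ?_⟩, ?_⟩
  · intro u hu
    by_cases hfin : weightedL1 w u = ∞
    · rw [hfin]; exact le_top
    have hu0 := (weightedL1_ne_top_iff w u).1 hfin
    rw [weightedL1_eq_ofReal hxw, weightedL1_eq_ofReal hu0]
    exact ENNReal.ofReal_le_ofReal (by linarith [sum_div_weight_add_le hμ hx hw hA hu hu0, hnn u])
  · rintro t ⟨hAt, hfin, hmin⟩
    have ht0 := (weightedL1_ne_top_iff w t).1 hfin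
    have hle := hmin x rfl
    rw [weightedL1_eq_ofReal hxw, weightedL1_eq_ofReal ht0, ENNReal.ofReal_le_ofReal_iff
      (Finset.sum_nonneg fun i _ => by positivity)] at hle
    have hgap := sum_div_weight_add_le hμ hx hw hA hAt ht0
    have hzero : ∑ i ∈ Iᶜ, |t i| / (w i : ℝ) = 0 := by
      refine le_antisymm ?_ (Finset.sum_nonneg fun i _ => by positivity)
      by_contra! hpos
      have := mul_pos (sub_pos.2 hC) hpos
      linarith
    have hoff : ∀ i ∉ I, t i = 0 := fun i hi => by
      have h := (Finset.sum_eq_zero_iff_of_nonneg (fun i _ => by positivity)).1 hzero i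
        (by simpa using hi)
      rcases div_eq_zero_iff.1 h with h | h
      · exact abs_eq_zero.1 h
      · exact ht0 i (NNReal.coe_eq_zero.1 h)
    have hnorm := hA (t - x) (by rw [Matrix.mulVec_sub, hAt, sub_self])
    have hcompl : ∑ i ∈ Iᶜ, |(t - x) i| = 0 := Finset.sum_eq_zero fun i hi => by
      have hi' : i ∉ I := by simpa using hi
      simp [hoff i hi', hx i hi']
    rw [hcompl, mul_zero, Real.sqrt_le_left le_rfl] at hnorm
    have hsq := (Finset.sum_eq_zero_iff_of_nonneg (fun i _ => sq_nonneg ((t - x) i))).1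
      (le_antisymm (by simpa using hnorm) (Finset.sum_nonneg fun i _ => sq_nonneg _))
    ext i
    by_cases hi : i ∈ I
    · simpa [sub_eq_zero] using hsq i hi
    · rw [hoff i hi, hx i hi]

/-- Applying the pseudo-inverse `L` of `A_I` to `A h = 0` gives `h_I = -∑_{j ∉ I} h_j L a_j`. -/
theorem sqrt_sum_sq_le_of_mulVec_eq_zero {m N : ℕ} {A : Matrix (Fin m) (Fin N) ℝ}
    {I : Finset (Fin N)} {μ : ℝ} (hμ : 0 ≤ μ)
    (hM : BoundedBelow (A.submatrix id (Subtype.val : I → Fin N)))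
    (hcol : ∀ j ∉ I, ∑ i, (leftPinv (A.submatrix id (Subtype.val : I → Fin N)) *ᵥ
      fun k => A k j) i ^ 2 ≤ μ ^ 2) {h : Fin N → ℝ} (hh : A *ᵥ h = 0) :
    √(∑ i ∈ I, h i ^ 2) ≤ μ * ∑ i ∈ Iᶜ, |h i| := by
  set M := A.submatrix id (Subtype.val : I → Fin N) with hMdef
  let hI : I → ℝ := fun i => h i
  have hsplit : M *ᵥ hI = -∑ j ∈ Iᶜ, h j • fun k => A k j := by
    ext k
    have hk := congrFun hh k
    simp only [Matrix.mulVec, dotProduct, Pi.zero_apply] at hk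
    rw [← Finset.sum_add_sum_compl I, ← Finset.sum_coe_sort I] at hk
    simp only [Matrix.mulVec, dotProduct, hMdef, Matrix.submatrix_apply, id, hI, Pi.neg_apply,
      Finset.sum_apply, Pi.smul_apply, smul_eq_mul]
    simp only [mul_comm (h _)]
    linarith
  have hrep : hI = -∑ j ∈ Iᶜ, h j • (leftPinv M *ᵥ fun k => A k j) := by
    calc hI = leftPinv M *ᵥ (M *ᵥ hI) := by
          rw [Matrix.mulVec_mulVec, hM.leftPinv_mul, Matrix.one_mulVec]
      _ = _ := by
          rw [hsplit, Matrix.mulVec_neg, Matrix.mulVec_sum]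
          simp only [Matrix.mulVec_smul]
  have hnorm : ∀ v : I → ℝ, ‖WithLp.toLp 2 v‖ = √(∑ i, v i ^ 2) := fun v => by
    rw [EuclideanSpace.norm_eq]; simp
  rw [← Finset.sum_coe_sort I]
  change √(∑ i, hI i ^ 2) ≤ _
  rw [← hnorm, hrep, WithLp.toLp_neg, norm_neg, WithLp.toLp_sum, Finset.mul_sum]
  refine norm_sum_le_of_le _ fun j hj => ?_
  rw [WithLp.toLp_smul, norm_smul, Real.norm_eq_abs, mul_comm, hnorm]
  gcongr
  exact (Real.sqrt_le_left hμ).2 (hcol j (by simpa using hj))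

end Deterministic

/-! ### Probability of the null space property -/

section Main

theorem pow_33_le_exp (s : ℕ) : (33 : ℝ) ^ s ≤ Real.exp (4 * s) := by
  have h : (33 : ℝ) ≤ Real.exp 4 := by
    have h1 : Real.exp 4 = Real.exp 1 ^ 4 := by rw [← Real.exp_nat_mul]; norm_num
    rw [h1]
    calc (33 : ℝ) ≤ 2.7 ^ 4 := by norm_num
      _ ≤ Real.exp 1 ^ 4 := by gcongr; linarith [Real.exp_one_gt_d9]
  calc (33 : ℝ) ^ s ≤ Real.exp 4 ^ s := by gcongr
    _ = Real.exp (4 * s) := by rw [← Real.exp_nat_mul, mul_comm]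

theorem two_mul_pow_33_mul_exp_le {m s : ℕ} {δ : ℝ} (hδ : 0 < δ) (hδ1 : δ < 1)
    (hms : 2000 * ((s : ℝ) / δ ^ 2) ≤ m) :
    2 * 33 ^ s * Real.exp (-((m : ℝ) / 5)) ≤ 2 * Real.exp (-(1 / 10 * m * δ ^ 2)) := by
  have hδ2 : δ ^ 2 ≤ 1 := pow_le_one₀ hδ.le hδ1.le
  have hs : (s : ℝ) ≤ s / δ ^ 2 := by
    rw [le_div_iff₀ (by positivity)]
    exact mul_le_of_le_one_right (by positivity) hδ2
  have hmδ : m * δ ^ 2 ≤ (m : ℝ) := mul_le_of_le_one_right (by positivity) hδ2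
  rw [mul_assoc]
  gcongr
  calc 33 ^ s * Real.exp (-((m : ℝ) / 5)) ≤ Real.exp (4 * s) * Real.exp (-((m : ℝ) / 5)) := by
        gcongr; exact pow_33_le_exp s
    _ = Real.exp (4 * s - m / 5) := by rw [← Real.exp_add]; rfl
    _ ≤ _ := by rw [Real.exp_le_exp]; linarith

/-- The assumption `2 ≤ N` makes `log N` bounded away from `0`, so that `s log N` dominates both
`log N` and `s`. -/
theorem card_mul_pow_33_mul_exp_le {m s N : ℕ} {μ : ℝ} (hμ : 0 < μ) (hs : 1 ≤ s) (hN : 2 ≤ N)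
    (hm : 2000 * ((s : ℝ) * Real.log N / μ ^ 2) ≤ m) :
    N * (33 ^ s * Real.exp (-(μ ^ 2 * m / 128))) ≤ Real.exp (-(1 / 256 * μ ^ 2 * m / s)) := by
  have hs' : (1 : ℝ) ≤ s := by exact_mod_cast hs
  have hN' : (0 : ℝ) < N := by positivity
  have hlog : 0.69 ≤ Real.log N := by
    have : Real.log 2 ≤ Real.log N := Real.log_le_log (by norm_num) (by exact_mod_cast hN)
    linarith [Real.log_two_gt_d9]
  have hm' : 2000 * (s * Real.log N) ≤ μ ^ 2 * m := by
    rw [← mul_div_assoc, div_le_iff₀ (by positivity)] at hm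
    linarith
  have h1 : Real.log N ≤ s * Real.log N := le_mul_of_one_le_left (by linarith) hs'
  have h2 : (s : ℝ) * 0.69 ≤ s * Real.log N := by gcongr
  have h3 : 1 / 256 * μ ^ 2 * m / s ≤ 1 / 256 * (μ ^ 2 * m) := by
    rw [mul_assoc]
    exact div_le_self (by positivity) hs'
  calc N * (33 ^ s * Real.exp (-(μ ^ 2 * m / 128)))
      ≤ Real.exp (Real.log N) * (Real.exp (4 * s) * Real.exp (-(μ ^ 2 * m / 128))) := by
        rw [Real.exp_log hN']
        gcongr
        exact pow_33_le_exp s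
    _ = Real.exp (Real.log N + (4 * s - μ ^ 2 * m / 128)) := by
        rw [← Real.exp_add, ← Real.exp_add]; rfl
    _ ≤ _ := by rw [Real.exp_le_exp]; linarith

/-- The exceptional set `B` need not be measurable; `P.real B` is its outer measure. -/
theorem exists_measureReal_le_and_nullSpace {Ω : Type*} [MeasurableSpace Ω] {P : Measure Ω}
    {m N : ℕ} {A : Ω → Matrix (Fin m) (Fin N) ℝ}
    (hA : ∀ i j, HasLaw (fun ω => A ω i j) (gaussianReal 0 (1 / (m : ℝ≥0))) P)
    (hind : iIndepFun (fun (p : Fin m × Fin N) ω => A ω p.1 p.2) P) (I : Finset (Fin N))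
    {μ δ : ℝ} (hμ : 0 < μ) (hδ : 0 < δ) (hδ1 : δ < 1)
    (hmδ : 2000 * ((I.card : ℝ) / δ ^ 2) ≤ m)
    (hmμ : 2000 * ((I.card : ℝ) * Real.log N / μ ^ 2) ≤ m) :
    ∃ B : Set Ω, P.real B ≤ 2 * Real.exp (-(1 / 10 * m * δ ^ 2)) +
        (if I.card = 0 then 0 else Real.exp (-(1 / 256 * μ ^ 2 * m / I.card))) ∧
      ∀ ω ∉ B, ∀ h : Fin N → ℝ, A ω *ᵥ h = 0 → √(∑ i ∈ I, h i ^ 2) ≤ μ * ∑ i ∈ Iᶜ, |h i| := by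
  have := hind.isProbabilityMeasure
  -- For empty `I` the null space property is trivial and no exceptional set is needed.
  rcases Nat.eq_zero_or_pos I.card with hs | hs
  · refine ⟨∅, by simp [hs]; positivity, fun ω _ h _ => ?_⟩
    rw [Finset.card_eq_zero.1 hs, Finset.sum_empty, Real.sqrt_zero]
    exact mul_nonneg hμ.le (Finset.sum_nonneg fun _ _ => abs_nonneg _)
  have hs' : (0 : ℝ) < I.card := by exact_mod_cast hs
  have hm : m ≠ 0 := by
    rintro rfl
    have : 0 < 2000 * ((I.card : ℝ) / δ ^ 2) := by positivity
    simp only [CharP.cast_eq_zero] at hmδ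
    linarith
  let M : Ω → Matrix (Fin m) I ℝ := fun ω => (A ω).submatrix id Subtype.val
  let B₁ : Set Ω := {ω | ¬ BoundedBelow (M ω)}
  let B₂ : Fin N → Set Ω := fun j => {ω | BoundedBelow (M ω) ∧
    μ ^ 2 < ∑ i, (leftPinv (M ω) *ᵥ fun k => A ω k j) i ^ 2}
  refine ⟨B₁ ∪ ⋃ j ∈ Iᶜ, B₂ j, ?_, fun ω hω h hh => ?_⟩
  · rw [if_neg hs.ne']
    refine (measureReal_union_le _ _).trans (add_le_add ?_ ?_)
    · have hMind : iIndepFun (fun (p : Fin m × I) ω => M ω p.1 p.2) P :=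
        hind.precomp (g := fun p : Fin m × I => (p.1, p.2.1))
          (Function.Injective.prodMap Function.injective_id Subtype.val_injective)
      have h := measureReal_not_boundedBelow_le hm (M := M) (fun k i => hA k i) hMind
      rw [Fintype.card_coe] at h
      exact h.trans (two_mul_pow_33_mul_exp_le hδ hδ1 hmδ)
    -- If `I` is everything, the union is empty; otherwise `N ≥ 2`, as `I` is non-empty.
    · rcases Finset.eq_empty_or_nonempty Iᶜ with hI | ⟨j, hj⟩
      · simp [hI]; positivity
      have hN : 2 ≤ N := by
        have h1 := I.card_add_card_compl
        have h2 := Finset.card_pos.2 ⟨j, hj⟩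
        rw [Fintype.card_fin] at h1
        omega
      refine le_trans ?_ (card_mul_pow_33_mul_exp_le hμ hs hN hmμ)
      calc P.real (⋃ j ∈ Iᶜ, B₂ j) ≤ ∑ j ∈ Iᶜ, P.real (B₂ j) :=
            measureReal_biUnion_finset_le _ _
        _ ≤ ∑ j ∈ Iᶜ, 33 ^ I.card * Real.exp (-(μ ^ 2 * m / 128)) :=
            Finset.sum_le_sum fun j hj =>
              measureReal_leftPinv_col_large_le hA hind I (by simpa using hj) hμ
        _ = Iᶜ.card * (33 ^ I.card * Real.exp (-(μ ^ 2 * m / 128))) := by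
            rw [Finset.sum_const, nsmul_eq_mul]
        _ ≤ _ := by
            gcongr
            simpa using Finset.card_le_univ Iᶜ
  · simp only [Set.mem_union, Set.mem_iUnion, exists_prop, not_or, not_exists, not_and] at hω
    have hM : BoundedBelow (M ω) := not_not.1 hω.1
    refine sqrt_sum_sq_le_of_mulVec_eq_zero hμ.le hM (fun j hj => ?_) hh
    exact not_lt.1 fun hlt => hω.2 j (by simpa using hj) ⟨hM, hlt⟩

end Main

theorem theorem2 :
    ∃ c₀ c₁ c₂ : ℝ, 0 < c₀ ∧ 0 < c₁ ∧ 0 < c₂ ∧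
      ∀ (m N : ℕ) (x : Fin N → ℝ) (I : Finset (Fin N)) (s : ℕ) (C μ δ : ℝ),
        I = vecSupport x → s = I.card →
        0 < C → 0 < μ → 0 < δ → δ < 1 →
        c₀ * max ((s : ℝ) / δ ^ 2) ((s : ℝ) * Real.log N / μ ^ 2) ≤ (m : ℝ) →
        C ≤ (1 - δ) / μ →
        ∀ (Ω : Type*) [MeasurableSpace Ω] (P : MeasureTheory.Measure Ω)
          [MeasureTheory.IsProbabilityMeasure P]
          (A : Ω → Matrix (Fin m) (Fin N) ℝ) (w : Ω → Fin N → ℝ≥0),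
          (∀ i j, ProbabilityTheory.HasLaw (fun ω => A ω i j)
            (ProbabilityTheory.gaussianReal 0 (1 / (m : ℝ≥0))) P) →
          ProbabilityTheory.iIndepFun (fun (p : Fin m × Fin N) ω => A ω p.1 p.2) P →
          ∃ E : Set Ω, MeasurableSet E ∧
            (∀ ω ∈ E, ExactlyReconstructs (A ω) (w ω) x) ∧
            1 - 2 * Real.exp (-(c₁ * m * δ ^ 2))
              - (if s = 0 then 0 else Real.exp (-(c₂ * μ ^ 2 * m / s)))
              - P.real {ω | WeightCondition (w ω) I C}ᶜ ≤ P.real E := by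
  refine ⟨2000, 1 / 10, 1 / 256, by norm_num, by norm_num, by norm_num, ?_⟩
  rintro m N x I s C μ δ hI rfl hC hμ hδ hδ1 hm hCμ Ω _ P _ A w hA hind
  rw [mul_max_of_nonneg _ _ (by norm_num), max_le_iff] at hm
  obtain ⟨B, hPB, hB⟩ := exists_measureReal_le_and_nullSpace hA hind I hμ hδ hδ1 hm.1 hm.2
  set V : Set Ω := {ω | WeightCondition (w ω) I C}ᶜ with hV
  refine ⟨(toMeasurable P (B ∪ V))ᶜ, (measurableSet_toMeasurable _ _).compl, fun ω hω => ?_, ?_⟩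
  · have hωBV : ω ∉ B ∪ V := fun h => hω (subset_toMeasurable _ _ h)
    rw [Set.mem_union, not_or] at hωBV
    have hx : ∀ i ∉ I, x i = 0 := fun i hi => by simpa [hI, vecSupport] using hi
    have hCμ1 : C * μ < 1 := by
      rw [le_div_iff₀ hμ] at hCμ
      linarith
    exact exactlyReconstructs_of_nullSpace hμ hCμ1 hx (not_not.1 hωBV.2) (hB ω hωBV.1)
  · have hreal : P.real (toMeasurable P (B ∪ V)) = P.real (B ∪ V) := by
      rw [measureReal_def, measure_toMeasurable, ← measureReal_def]
    rw [probReal_compl_eq_one_sub (measurableSet_toMeasurable _ _), hreal]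
    linarith [measureReal_union_le (μ := P) B V]
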